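/- Let $\mathfrak{S}=\bigcup_{n\ge 0}\mathfrak{S}_n$ be the set of all permutations, where $\mathfrak{S}_n$ is the set of permutations of $\{1,\dots,n\}$. For $\pi\in\mathfrak{S}_n$ let $G_{12}(\pi)$ be the graph whose vertices are the sets $\{i,j\}$ with $1\le i<j\le n$ and $\pi(i)<\pi(j)$ (the occurrences of the pattern $12$), two vertices $u,v$ being adjacent if $|u\setminus v|=|v\setminus u|=1$. The graph without vertices counts as connected. Let $m$ be the mesh pattern with underlying permutation $3412$ and shaded boxes $$(0,0),(0,1),(1,0),(1,1),(2,0),(2,1),(3,2),(3,3),(3,4),(4,2),(4,3),(4,4),$$ where the box $(a,b)$ is the open unit square with lower left corner $(a,b)$. An occurrence of $m$ in $\pi\in\mathfrak{S}_n$ consists of indices $1\le i_1<i_2<i_3<i_4\le n$ with $\pi(i_3)<\pi(i_4)<\pi(i_1)<\pi(i_2)$ such that, with $i_0=0$, $i_5=n+1$, and with $v_1<v_2<v_3<v_4$ the values $\pi(i_1),\dots,\pi(i_4)$ in increasing order, $v_0=0$, $v_5=n+1$, for no shaded box $(a,b)$ is there an index $x$ with $i_a<x<i_{a+1}$ and $v_b<\pi(x)<v_{b+1}$.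 The permutation $\pi$ avoids $m$ if it has no such occurrence. **Theorem.** For every $\pi\in\mathfrak{S}$, the graph $G_{12}(\pi)$ is connected if and only if $\pi$ avoids $m$. The ordinary generating function, by length $n\ge 0$, of the permutations $\pi$ for which $G_{12}(\pi)$ is connected is $$\frac{F(x)-x}{(1-x)^2}+\frac{1}{1-x},\qquad F(x)=1-\frac{1}{\sum_{k\ge 0}k!\,x^k},$$ and $F(x)$ is the ordinary generating function, by length, of the skew-indecomposable permutations, that is, of the nonempty permutations $\pi\in\mathfrak{S}_n$ for which there is no $k$ with $1\le k<n$ such that $\pi(i)>\pi(j)$ whenever $i\le k<j$. -/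

import Mathlib

namespace OccGraph

open Equiv

/-- An order-preserving index injection `f` is an occurrence of the pattern `p` in `π` if
`π (f 0), π (f 1), …` is order isomorphic to `p 0, p 1, …`. Positions and values are numbered
from `0`. -/
def IsOccurrence {k n : ℕ} (p : Perm (Fin k)) (π : Perm (Fin n)) (f : Fin k ↪o Fin n) : Prop :=
  ∀ i j : Fin k, π (f i) < π (f j) ↔ p i < p j

/-- The set `V_p(π)` of index sets of occurrences of `p` in `π`. -/
def occurrenceSet {k n : ℕ} (p : Perm (Fin k)) (π : Perm (Fin n)) : Set (Finset (Fin n)) :=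
  {s | ∃ f : Fin k ↪o Fin n, IsOccurrence p π f ∧ s = Finset.univ.map f.toEmbedding}

/-- The occurrence graph `G_p(π)`: the vertices are the index sets of occurrences of `p` in `π`,
and two of them are adjacent if they differ by exactly one element. -/
def occurrenceGraph {k n : ℕ} (p : Perm (Fin k)) (π : Perm (Fin n)) :
    SimpleGraph (occurrenceSet p π) where
  Adj u v := (u.1 \ v.1).card = 1 ∧ (v.1 \ u.1).card = 1
  symm := ⟨fun _ _ h => ⟨h.2, h.1⟩⟩
  loopless := ⟨fun u h => by simp at h⟩

/-- The set of all permutations, of all lengths `n ≥ 0`. -/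
abbrev AllPerm : Type := Σ n : ℕ, Perm (Fin n)

/-- The set of permutations `π` whose occurrence graph `G_p(π)` has the property `c`. -/
def graphClass {k : ℕ} (p : Perm (Fin k)) (c : ∀ V : Type, SimpleGraph V → Prop) : Set AllPerm :=
  {π | c _ (occurrenceGraph p π.2)}

/-- A mesh pattern of length `k`: an underlying permutation with a set of shaded boxes. The box
`(a, b)` is the open unit square with lower left corner `(a, b)`, where the points of the
underlying permutation have coordinates `(1, ·), …, (k, ·)` and values `1, …, k`. -/
structure MeshPattern (k : ℕ) where
  perm : Perm (Fin k)
  shading : Finset (Fin (k + 1) × Fin (k + 1))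

/-- The point `(x, π x)` of `π` lies in the region that corresponds to the box `(a, b)` under the
occurrence `f` of `p`: exactly the first `a` points of the occurrence are to the left of it and
the others to the right, exactly the `b` lowest points of the occurrence are below it and
the others above. -/
def InBox {k n : ℕ} (p : Perm (Fin k)) (π : Perm (Fin n)) (f : Fin k ↪o Fin n)
    (a b : Fin (k + 1)) (x : Fin n) : Prop :=
  (∀ j : Fin k, j.val < a.val → f j < x) ∧ (∀ j : Fin k, a.val ≤ j.val → x < f j) ∧
  (∀ j : Fin k, (p j).val < b.val → π (f j) < π x) ∧
  (∀ j : Fin k, b.val ≤ (p j).val → π x < π (f j))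

/-- An occurrence of a mesh pattern is an occurrence of its underlying permutation for which no
point of `π` lies in the region of a shaded box. -/
def IsMeshOccurrence {k n : ℕ} (m : MeshPattern k) (π : Perm (Fin n)) (f : Fin k ↪o Fin n) :
    Prop :=
  IsOccurrence m.perm π f ∧ ∀ c ∈ m.shading, ∀ x : Fin n, ¬ InBox m.perm π f c.1 c.2 x

/-- `Av(m)`: the permutations without an occurrence of the mesh pattern `m`. -/
def meshAv {k : ℕ} (m : MeshPattern k) : Set AllPerm :=
  {π | ¬ ∃ f : Fin k ↪o Fin π.1, IsMeshOccurrence m π.2 f}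

/-- The pattern `12`. -/
def p12 : Perm (Fin 2) := Equiv.refl (Fin 2)

/-- The pattern `3412`, with values numbered from `0`. -/
def p3412 : Perm (Fin 4) where
  toFun := ![2, 3, 0, 1]
  invFun := ![2, 3, 0, 1]
  left_inv := by decide
  right_inv := by decide

/-- The mesh pattern `m`. -/
def m : MeshPattern 4 where
  perm := p3412
  shading := {(0, 0), (0, 1), (1, 0), (1, 1), (2, 0), (2, 1),
    (3, 2), (3, 3), (3, 4), (4, 2), (4, 3), (4, 4)}

/-- The ordinary generating function, by length, of a set of permutations. -/
noncomputable def genFun (A : Set AllPerm) : PowerSeries ℚ :=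
  PowerSeries.mk fun n => (Nat.card {π : Perm (Fin n) // (⟨n, π⟩ : AllPerm) ∈ A} : ℚ)

/-- The skew-indecomposable permutations: the nonempty permutations `π` that are not a skew sum
of two nonempty permutations, that is, no proper nonempty prefix of `π` has all its values above
all the values of the remaining suffix. -/
def skewIndecomposables : Set AllPerm :=
  {π | 0 < π.1 ∧ ¬ ∃ k : ℕ, 0 < k ∧ k < π.1 ∧
    ∀ i j : Fin π.1, i.val < k → k ≤ j.val → π.2 j < π.2 i}

/-- `F(x) = 1 - 1 / ∑_{k ≥ 0} k! x^k`. -/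
noncomputable def F : PowerSeries ℚ :=
  1 - (PowerSeries.mk fun k => (k.factorial : ℚ))⁻¹

end OccGraph

/-! ### Connectedness and cuts -/

namespace OccGraph

open Equiv

/-! No non-inversion straddles a cut, so a cut with non-inversions on both sides disconnects the
graph. Conversely, a position that is not a cut is straddled by some non-inversion, and all
non-inversions straddling one position lie in one component (`reachable_of_crossing`); chaining
through consecutive non-cuts joins any two vertices when no cut separates. An occurrence of `m` is a
separating cut normalised so that the suffix does not begin with its maximum (`graphClass_eq`).

For counting, a nonempty permutation is uniquely `σ ⊖ τ` with `σ` skew-indecomposable. With `P = ∑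
k! x^k` this gives `P = 1 + F P`. If `σ` is a point, a separating cut exists exactly when `τ` has
one; a longer `σ` contains a non-inversion, so `τ` must be decreasing. Hence `C = 1 + x C + (F -
x)/(1 - x)` for the connected class. -/

/-- The prefix of length `k` lies above the remaining suffix. -/
def IsCut {n : ℕ} (π : Perm (Fin n)) (k : ℕ) : Prop :=
  ∀ i j : Fin n, i.val < k → k ≤ j.val → π j < π i

/-- A non-inversion of `π`. -/
def IsAscent {n : ℕ} (π : Perm (Fin n)) (i j : Fin n) : Prop := i < j ∧ π i < π j

/-- Some cut of `π` has non-inversions on both sides. -/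
def HasSeparatingCut {n : ℕ} (π : Perm (Fin n)) : Prop :=
  ∃ k : ℕ, IsCut π k ∧ (∃ i j, IsAscent π i j ∧ j.val < k) ∧ ∃ i j, IsAscent π i j ∧ k ≤ i.val

variable {n : ℕ} {π : Perm (Fin n)}

theorem exists_orderEmbedding_of_strictMono {k : ℕ} {g : Fin k → Fin n} (hg : StrictMono g) :
    ∃ f : Fin k ↪o Fin n, ∀ a, f a = g a :=
  ⟨OrderEmbedding.ofStrictMono g hg, fun _ => rfl⟩

theorem mem_occurrenceSet_p12 {s : Finset (Fin n)} :
    s ∈ occurrenceSet p12 π ↔ ∃ i j, IsAscent π i j ∧ s = {i, j} := by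
  constructor
  · rintro ⟨f, hf, rfl⟩
    refine ⟨f 0, f 1, ⟨by simp, ?_⟩, ?_⟩
    · rw [hf]; simp [p12]
    · ext x; simp [Fin.exists_fin_two, eq_comm]
  · rintro ⟨i, j, ⟨hij, hπ⟩, rfl⟩
    obtain ⟨f, hf⟩ := exists_orderEmbedding_of_strictMono (g := ![i, j])
      (by intro a b; fin_cases a <;> fin_cases b <;> simp [hij])
    refine ⟨f, ?_, ?_⟩
    · intro a b; fin_cases a <;> fin_cases b <;> simp [p12, hf, hπ, hπ.le]
    · ext x; simp [Fin.exists_fin_two, hf, eq_comm]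

/-- The vertex of the occurrence graph given by a non-inversion. -/
def IsAscent.vertex {i j : Fin n} (h : IsAscent π i j) : occurrenceSet p12 π :=
  ⟨{i, j}, mem_occurrenceSet_p12.2 ⟨i, j, h, rfl⟩⟩

theorem exists_eq_vertex (u : occurrenceSet p12 π) :
    ∃ i j, ∃ h : IsAscent π i j, u = h.vertex := by
  obtain ⟨i, j, h, hu⟩ := mem_occurrenceSet_p12.1 u.2
  exact ⟨i, j, h, Subtype.ext hu⟩

theorem card_vertex (u : occurrenceSet p12 π) : u.1.card = 2 := by
  obtain ⟨i, j, h, rfl⟩ := exists_eq_vertex u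
  exact Finset.card_pair h.1.ne

theorem reachable_of_mem {u v : occurrenceSet p12 π} {x : Fin n} (hu : x ∈ u.1) (hv : x ∈ v.1) :
    (occurrenceGraph p12 π).Reachable u v := by
  have h1 := Finset.card_sdiff_add_card_inter u.1 v.1
  have h2 := Finset.card_sdiff_add_card_inter v.1 u.1
  rw [Finset.inter_comm] at h2
  rw [card_vertex] at h1 h2
  have h3 : 0 < (u.1 ∩ v.1).card := Finset.card_pos.2 ⟨x, Finset.mem_inter.2 ⟨hu, hv⟩⟩
  by_cases h4 : (u.1 \ v.1).card = 1
  · exact SimpleGraph.Adj.reachable ⟨h4, by omega⟩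
  · have h5 : u.1 \ v.1 = ∅ := Finset.card_eq_zero.1 (by omega)
    have h6 : v.1 \ u.1 = ∅ := Finset.card_eq_zero.1 (by rw [h5] at h1; simp at h1; omega)
    have : u = v := Subtype.ext
      ((Finset.sdiff_eq_empty_iff_subset.1 h5).antisymm (Finset.sdiff_eq_empty_iff_subset.1 h6))
    exact this ▸ SimpleGraph.Reachable.refl _

/-- Joining the left end of smaller value to the right end of the other pair gives a non-inversion
that meets both. -/
theorem reachable_of_crossing {k : ℕ} {i j i' j' : Fin n} (h : IsAscent π i j)
    (h' : IsAscent π i' j') (hi : i.val < k) (hj : k ≤ j.val) (hi' : i'.val < k)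
    (hj' : k ≤ j'.val) : (occurrenceGraph p12 π).Reachable h.vertex h'.vertex := by
  wlog hle : π i ≤ π i' generalizing i j i' j'
  · exact (this h' h hi' hj' hi hj (le_of_not_ge hle)).symm
  have h'' : IsAscent π i j' := ⟨Fin.lt_def.2 (by omega), hle.trans_lt h'.2⟩
  exact (reachable_of_mem (x := i) (v := h''.vertex) (by simp [IsAscent.vertex])
    (by simp [IsAscent.vertex])).trans
    (reachable_of_mem (x := j') (by simp [IsAscent.vertex]) (by simp [IsAscent.vertex]))

theorem reachable_of_no_cut {k l : ℕ} (hkl : k ≤ l)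
    (hcut : ∀ r, k ≤ r → r ≤ l → ¬ IsCut π r) {i j i' j' : Fin n} (h : IsAscent π i j)
    (h' : IsAscent π i' j') (hi : i.val < k) (hj : k ≤ j.val) (hi' : i'.val < l)
    (hj' : l ≤ j'.val) : (occurrenceGraph p12 π).Reachable h.vertex h'.vertex := by
  induction l, hkl using Nat.le_induction generalizing i' j' with
  | base => exact reachable_of_crossing h h' hi hj hi' hj'
  | succ l hkl ih =>
    have hl := hcut l hkl (by omega)
    simp only [IsCut, not_forall] at hl
    obtain ⟨a, b, ha, hb, hab⟩ := hl
    have hne : a ≠ b := by rintro rfl; omega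
    have hasc : IsAscent π a b := ⟨Fin.lt_def.2 (by omega),
      lt_of_le_of_ne (not_lt.1 hab) (π.injective.ne hne)⟩
    refine (ih (fun r h1 h2 => hcut r h1 (by omega)) hasc ha hb).trans ?_
    by_cases h1 : l + 1 ≤ b.val
    · exact reachable_of_crossing hasc h' (by omega) h1 hi' hj'
    by_cases h2 : i'.val < l
    · exact reachable_of_crossing hasc h' ha hb h2 (by omega)
    have : b = i' := Fin.ext (by omega)
    subst this
    -- Here `b` and `i'` both sit at position `l`, so the two pairs share a point.
    exact reachable_of_mem (x := b) (by simp [IsAscent.vertex]) (by simp [IsAscent.vertex])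

theorem preconnected_of_not_hasSeparatingCut (hπ : ¬ HasSeparatingCut π) :
    (occurrenceGraph p12 π).Preconnected := by
  intro u v
  obtain ⟨a, b, h, rfl⟩ := exists_eq_vertex u
  obtain ⟨c, d, h', rfl⟩ := exists_eq_vertex v
  wlog hbd : b ≤ d generalizing a b c d
  · exact (this c d h' a b h (le_of_not_ge hbd)).symm
  have hab : a.val < b.val := h.1
  have hcd : c.val < d.val := h'.1
  have hbd : b.val ≤ d.val := hbd
  by_cases hcb : c.val < b.val
  · exact reachable_of_crossing (k := b.val) h h' hab le_rfl hcb hbd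
  -- `b` is the last position straddled by the first pair and `c + 1` the first straddled by the
  -- second; a cut in between would separate them.
  refine reachable_of_no_cut (k := b.val) (l := c.val + 1) (by omega) ?_ h h' hab le_rfl
    (by omega) (by omega)
  intro r hbr hrc hr
  have h1 : b.val ≠ r := by
    rintro rfl
    exact lt_asymm h.2 (hr a b hab le_rfl)
  have h2 : r ≠ c.val + 1 := by
    rintro rfl
    exact lt_asymm h'.2 (hr c d (by omega) (by omega))
  exact hπ ⟨r, hr, ⟨a, b, h, by omega⟩, ⟨c, d, h', by omega⟩⟩

theorem not_preconnected_of_hasSeparatingCut (hπ : HasSeparatingCut π) :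
    ¬ (occurrenceGraph p12 π).Preconnected := by
  obtain ⟨k, hk, ⟨a, b, h, hb⟩, ⟨c, d, h', hc⟩⟩ := hπ
  intro hconn
  -- Lying wholly before the cut is invariant along walks: neighbours share a point, and no
  -- non-inversion straddles the cut.
  have key : ∀ u v, (occurrenceGraph p12 π).Reachable u v → (∀ x ∈ u.1, x.val < k) →
      ∀ x ∈ v.1, x.val < k := by
    rintro u v ⟨w⟩
    induction w with
    | nil => exact id
    | @cons u v w huv _ ih =>
      intro hu
      refine ih ?_
      have h1 := Finset.card_sdiff_add_card_inter u.1 v.1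
      rw [card_vertex, huv.1] at h1
      obtain ⟨x, hx⟩ := Finset.card_pos.1 (show 0 < (u.1 ∩ v.1).card by omega)
      obtain ⟨hxu, hxv⟩ := Finset.mem_inter.1 hx
      have hxk := hu x hxu
      obtain ⟨i, j, hij, rfl⟩ := exists_eq_vertex v
      have hlt : i.val < j.val := hij.1
      have hik : i.val < k := by
        rcases (by simpa [IsAscent.vertex] using hxv : x = i ∨ x = j) with rfl | rfl <;> omega
      have hjk : j.val < k := by
        by_contra hjk
        exact lt_asymm hij.2 (hk i j hik (by omega))
      intro y hy
      rcases (by simpa [IsAscent.vertex] using hy : y = i ∨ y = j) with rfl | rfl <;> assumption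
  have hab : a.val < b.val := h.1
  have := key _ _ (hconn h.vertex h'.vertex) (by
    intro y hy
    rcases (by simpa [IsAscent.vertex] using hy : y = a ∨ y = b) with rfl | rfl <;> omega)
    c (by simp [IsAscent.vertex])
  omega

theorem preconnected_iff : (occurrenceGraph p12 π).Preconnected ↔ ¬ HasSeparatingCut π :=
  ⟨fun h h' => not_preconnected_of_hasSeparatingCut h' h, preconnected_of_not_hasSeparatingCut⟩

/-! ### The mesh pattern -/

theorem isOccurrence_p3412_iff {f : Fin 4 ↪o Fin n} : IsOccurrence p3412 π f ↔
    π (f 2) < π (f 3) ∧ π (f 3) < π (f 0) ∧ π (f 0) < π (f 1) := by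
  constructor
  · intro h
    exact ⟨(h 2 3).2 (by decide), (h 3 0).2 (by decide), (h 0 1).2 (by decide)⟩
  · rintro ⟨h1, h2, h3⟩ i j
    fin_cases i <;> fin_cases j <;> simp [p3412] <;> order

/-- The shaded boxes fill two rectangles: left of `f 2` and below `π (f 3)`, right of `f 2` and
above `π (f 3)`. Points on the grid lines belong to the occurrence and satisfy the inequalities
anyway. -/
theorem isMeshOccurrence_m_iff {f : Fin 4 ↪o Fin n} : IsMeshOccurrence m π f ↔
    IsOccurrence p3412 π f ∧ (∀ x < f 2, π (f 3) < π x) ∧ ∀ x, f 2 ≤ x → π x ≤ π (f 3) := by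
  refine and_congr_right fun hocc => ?_
  obtain ⟨v01, v12, v23⟩ := isOccurrence_p3412_iff.1 hocc
  have f01 : f 0 < f 1 := by simp
  have f12 : f 1 < f 2 := by simp
  have f23 : f 2 < f 3 := by simp
  constructor
  · intro hbox
    simp only [m, Finset.mem_insert, Finset.mem_singleton, forall_eq_or_imp, forall_eq] at hbox
    simp only [InBox, Fin.forall_fin_succ, p3412] at hbox
    simp at hbox
    obtain ⟨b00, b01, b10, b11, b20, b21, b32, b33, b34, b42, b43, b44⟩ := hbox
    constructor
    · intro x hx
      by_contra hlt
      have h2 : π x ≠ π (f 2) := π.injective.ne hx.ne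
      have h0 : x ≠ f 0 := by rintro rfl; exact hlt v12
      have h1 : x ≠ f 1 := by rintro rfl; exact hlt (v12.trans v23)
      have h3 : π x ≠ π (f 3) := π.injective.ne (hx.trans f23).ne
      have hlt : π x < π (f 3) := lt_of_le_of_ne (not_lt.1 hlt) h3
      rcases lt_or_gt_of_ne h0 with h0 | h0 <;> rcases lt_or_gt_of_ne h1 with h1 | h1 <;>
        rcases lt_or_gt_of_ne h2 with h2 | h2 <;> grind
    · intro x hx
      by_contra hlt
      have h2 : x ≠ f 2 := by rintro rfl; exact hlt v01.le
      have h3 : x ≠ f 3 := by rintro rfl; exact hlt le_rfl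
      have hx : f 2 < x := lt_of_le_of_ne hx h2.symm
      have h0 : π x ≠ π (f 0) := π.injective.ne (by order)
      have h1 : π x ≠ π (f 1) := π.injective.ne (by order)
      rcases lt_or_gt_of_ne h0 with h0 | h0 <;> rcases lt_or_gt_of_ne h1 with h1 | h1 <;>
        rcases lt_or_gt_of_ne h3 with h3 | h3 <;> grind
  · rintro ⟨left, right⟩
    have hm : ∀ c ∈ m.shading, (c.1.val ≤ 2 ∧ c.2.val ≤ 1) ∨ (2 < c.1.val ∧ 1 < c.2.val) := by
      decide
    intro c hc x ⟨hl, hr, hb, ht⟩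
    rcases hm c hc with ⟨ha, hb'⟩ | ⟨ha, hb'⟩
    · exact lt_asymm (left x (hr 2 ha)) (ht 3 hb')
    · exact (right x (hl 2 ha).le).not_gt (hb 3 hb')

theorem hasSeparatingCut_of_isMeshOccurrence {f : Fin 4 ↪o Fin n} (hf : IsMeshOccurrence m π f) :
    HasSeparatingCut π := by
  obtain ⟨hocc, left, right⟩ := isMeshOccurrence_m_iff.1 hf
  obtain ⟨v01, -, v23⟩ := isOccurrence_p3412_iff.1 hocc
  exact ⟨(f 2).val, fun i j hi hj => (right j hj).trans_lt (left i hi),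
    ⟨f 0, f 1, ⟨by simp, v23⟩, (by simp : f 1 < f 2)⟩, ⟨f 2, f 3, ⟨by simp, v01⟩, le_rfl⟩⟩

theorem exists_isMeshOccurrence (hπ : HasSeparatingCut π) :
    ∃ f : Fin 4 ↪o Fin n, IsMeshOccurrence m π f := by
  -- A separating cut whose successor does not separate; it exists because position `k + n` leaves
  -- no suffix.
  obtain ⟨k, ⟨hk, ⟨a, b, hab, hb⟩, ⟨c, d, hcd, hc⟩⟩, hmax⟩ :
      ∃ k, (IsCut π k ∧ (∃ i j, IsAscent π i j ∧ j.val < k) ∧ ∃ i j, IsAscent π i j ∧ k ≤ i.val) ∧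
        ¬ (IsCut π (k + 1) ∧ (∃ i j, IsAscent π i j ∧ j.val < k + 1) ∧
          ∃ i j, IsAscent π i j ∧ k + 1 ≤ i.val) := by
    by_contra! hstep
    obtain ⟨k, hk⟩ := hπ
    have hall : ∀ r, k ≤ r → IsCut π r ∧ (∃ i j, IsAscent π i j ∧ j.val < r) ∧
        ∃ i j, IsAscent π i j ∧ r ≤ i.val := by
      intro r hr
      induction r, hr using Nat.le_induction with
      | base => exact hk
      | succ r _ ih => exact hstep r ih
    obtain ⟨-, -, i, -, -, hi⟩ := hall (k + n) (by omega)
    omega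
  have hlt : c.val < d.val := hcd.1
  have hkn : k < n := by omega
  obtain ⟨t, ht, htmax⟩ := Finset.exists_max_image
    (Finset.univ.filter fun j : Fin n => k ≤ j.val) π ⟨c, by simpa using hc⟩
  simp only [Finset.mem_filter, Finset.mem_univ, true_and] at ht htmax
  -- If the suffix began with its maximum, that entry would start no non-inversion, and `k + 1`
  -- would still separate.
  have htk : k ≠ t.val := by
    intro htk
    refine hmax ⟨fun i j hi hj => ?_, ⟨a, b, hab, by omega⟩, ⟨c, d, hcd, ?_⟩⟩
    · by_cases hik : i.val < k
      · exact hk i j hik (by omega)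
      · have : i = t := Fin.ext (by omega)
        subst this
        exact lt_of_le_of_ne (htmax j (by omega)) (π.injective.ne (by rintro rfl; omega))
    · by_contra hck
      have : c = t := Fin.ext (by omega)
      subst this
      exact (htmax d (by omega)).not_gt hcd.2
  obtain ⟨f, hf⟩ := exists_orderEmbedding_of_strictMono (g := ![a, b, ⟨k, hkn⟩, t]) (by
    have h1 := hab.1
    have h2 : b < ⟨k, hkn⟩ := hb
    have h3 : (⟨k, hkn⟩ : Fin n) < t := Fin.lt_def.2 (show k < t.val by omega)
    intro i j
    fin_cases i <;> fin_cases j <;> simp <;> order)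
  have ha : a.val < k := lt_trans hab.1 hb
  refine ⟨f, isMeshOccurrence_m_iff.2 ⟨isOccurrence_p3412_iff.2 ⟨?_, ?_, ?_⟩, ?_, ?_⟩⟩
  · have := π.injective.ne (show (⟨k, hkn⟩ : Fin n) ≠ t from fun h => htk (congrArg Fin.val h))
    simpa [hf] using lt_of_le_of_ne (htmax ⟨k, hkn⟩ le_rfl) this
  · simpa [hf] using hk a t ha ht
  · simpa [hf] using hab.2
  · intro x hx
    simpa [hf] using hk x t (by simpa [hf] using Fin.lt_def.1 hx) ht
  · intro x hx
    simpa [hf] using htmax x (by simpa [hf] using Fin.le_def.1 hx)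

theorem graphClass_eq : graphClass p12 (fun _ G => G.Preconnected) = meshAv m := by
  ext π
  exact preconnected_iff.trans (not_congr ⟨exists_isMeshOccurrence,
    fun ⟨_, hf⟩ => hasSeparatingCut_of_isMeshOccurrence hf⟩)

end OccGraph

/-! ### Skew sums and the first indecomposable block -/

namespace OccGraph

open Equiv

/-- The skew sum `σ ⊖ τ`: the values of `σ` are raised above those of `τ`. -/
def skewSum {k l : ℕ} (σ : Perm (Fin k)) (τ : Perm (Fin l)) : Perm (Fin (k + l)) :=
  (finSumFinEquiv.symm.trans (sumCongr σ τ)).trans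
    ((sumComm _ _).trans (finSumFinEquiv.trans (finCongr (add_comm l k))))

variable {k l : ℕ} {σ : Perm (Fin k)} {τ : Perm (Fin l)}

theorem skewSum_castAdd (i : Fin k) : (skewSum σ τ (Fin.castAdd l i)).val = l + (σ i).val := by
  simp [skewSum, add_comm]

theorem skewSum_natAdd (j : Fin l) : (skewSum σ τ (Fin.natAdd k j)).val = (τ j).val := by
  simp [skewSum]

theorem skewSum_castAdd_lt_castAdd {i j : Fin k} :
    skewSum σ τ (Fin.castAdd l i) < skewSum σ τ (Fin.castAdd l j) ↔ σ i < σ j := by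
  simp only [Fin.lt_def, skewSum_castAdd]; omega

theorem skewSum_natAdd_lt_natAdd {i j : Fin l} :
    skewSum σ τ (Fin.natAdd k i) < skewSum σ τ (Fin.natAdd k j) ↔ τ i < τ j := by
  simp only [Fin.lt_def, skewSum_natAdd]

theorem skewSum_natAdd_lt_castAdd (i : Fin k) (j : Fin l) :
    skewSum σ τ (Fin.natAdd k j) < skewSum σ τ (Fin.castAdd l i) := by
  simp only [Fin.lt_def, skewSum_castAdd, skewSum_natAdd]; omega

theorem skewSum_inj {σ' : Perm (Fin k)} {τ' : Perm (Fin l)} (h : skewSum σ τ = skewSum σ' τ') :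
    σ = σ' ∧ τ = τ' := by
  constructor
  · ext i
    have := congrArg Fin.val (DFunLike.congr_fun h (Fin.castAdd l i))
    simpa [skewSum_castAdd] using this
  · ext j
    have := congrArg Fin.val (DFunLike.congr_fun h (Fin.natAdd k j))
    simpa [skewSum_natAdd] using this

theorem isCut_skewSum_iff {r : ℕ} (hr : r ≤ k) : IsCut (skewSum σ τ) r ↔ IsCut σ r := by
  constructor
  · intro h i j hi hj
    exact skewSum_castAdd_lt_castAdd.1 (h (Fin.castAdd l i) (Fin.castAdd l j) hi hj)
  · intro h i j hi hj
    induction i using Fin.addCases with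
    | right i => simp at hi; omega
    | left i =>
      induction j using Fin.addCases with
      | left j => exact skewSum_castAdd_lt_castAdd.2 (h i j hi hj)
      | right j => exact skewSum_natAdd_lt_castAdd i j

theorem isCut_length {n : ℕ} (π : Perm (Fin n)) : IsCut π n := fun _ j _ hj =>
  absurd j.2 (not_lt.2 hj)

/-- The `l` distinct suffix values all lie below this one. -/
theorem le_of_isCut {π : Perm (Fin (k + l))} (h : IsCut π k) (i : Fin k) :
    l ≤ (π (Fin.castAdd l i)).val := by
  have hsub : Finset.univ.image (fun j : Fin l => (π (Fin.natAdd k j)).val) ⊆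
      Finset.range (π (Fin.castAdd l i)).val := by
    intro x hx
    obtain ⟨j, -, rfl⟩ := Finset.mem_image.1 hx
    exact Finset.mem_range.2 (h (Fin.castAdd l i) (Fin.natAdd k j) (by simp) (by simp))
  have hcard := Finset.card_le_card hsub
  rwa [Finset.card_image_of_injective, Finset.card_univ, Fintype.card_fin,
    Finset.card_range] at hcard
  intro a b hab
  simpa using π.injective (Fin.ext hab)

theorem exists_eq_skewSum {π : Perm (Fin (k + l))} (h : IsCut π k) :
    ∃ (σ : Perm (Fin k)) (τ : Perm (Fin l)), π = skewSum σ τ := by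
  let e : Fin k ⊕ Fin l ≃ Fin (k + l) :=
    (sumComm _ _).trans (finSumFinEquiv.trans (finCongr (add_comm l k)))
  obtain ⟨⟨σ, τ⟩, hστ⟩ := Equiv.Perm.mem_sumCongrHom_range_of_perm_mapsTo_inl
    (σ := (finSumFinEquiv.trans π).trans e.symm) (by
      rintro _ ⟨i, rfl⟩
      have hi := le_of_isCut h i
      refine ⟨⟨(π (Fin.castAdd l i)).val - l, by omega⟩, ?_⟩
      rw [Equiv.trans_apply, Equiv.trans_apply, Equiv.eq_symm_apply]
      apply Fin.ext
      simp [e]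
      omega)
  refine ⟨σ, τ, ?_⟩
  have hστ : sumCongr σ τ = (finSumFinEquiv.trans π).trans e.symm := hστ
  rw [skewSum, hστ]
  ext i
  simp [e]

theorem mem_skewIndecomposables_iff : (⟨k, σ⟩ : AllPerm) ∈ skewIndecomposables ↔
    0 < k ∧ ∀ r, 0 < r → r < k → ¬ IsCut σ r := by
  simp [skewIndecomposables, IsCut]

/-- The length of the first skew-indecomposable block. -/
noncomputable def firstCut {n : ℕ} (π : Perm (Fin n)) : ℕ := sInf {r | 0 < r ∧ IsCut π r}

theorem firstCut_le {n r : ℕ} {π : Perm (Fin n)} (hr : 0 < r) (h : IsCut π r) : firstCut π ≤ r :=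
  Nat.sInf_le ⟨hr, h⟩

theorem firstCut_spec {n : ℕ} (hn : 0 < n) (π : Perm (Fin n)) :
    0 < firstCut π ∧ IsCut π (firstCut π) :=
  Nat.sInf_mem (s := {r | 0 < r ∧ IsCut π r}) ⟨n, hn, isCut_length π⟩

theorem firstCut_skewSum (h : (⟨k, σ⟩ : AllPerm) ∈ skewIndecomposables) :
    firstCut (skewSum σ τ) = k := by
  rw [mem_skewIndecomposables_iff] at h
  have hle : firstCut (skewSum σ τ) ≤ k :=
    firstCut_le h.1 ((isCut_skewSum_iff le_rfl).2 (isCut_length σ))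
  obtain ⟨hpos, hcut⟩ := firstCut_spec (by omega) (skewSum σ τ)
  by_contra hne
  exact h.2 _ hpos (by omega) ((isCut_skewSum_iff hle).1 hcut)

-- Splitting at the first cut is a bijection: minimality makes the prefix skew-indecomposable. The
-- class `A` is left general, to serve both for all permutations and for the connected class.
open Classical in
theorem card_eq_sum_antidiagonal (A : Set AllPerm) {n : ℕ} (hn : 0 < n) :
    Nat.card {π : Perm (Fin n) // (⟨n, π⟩ : AllPerm) ∈ A} =
      ∑ p ∈ Finset.HasAntidiagonal.antidiagonal n, Nat.card {q : Perm (Fin p.1) × Perm (Fin p.2) //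
        (⟨p.1, q.1⟩ : AllPerm) ∈ skewIndecomposables ∧
          (⟨p.1 + p.2, skewSum q.1 q.2⟩ : AllPerm) ∈ A} := by
  simp only [Nat.card_eq_fintype_card, Fintype.card_subtype]
  rw [Finset.card_eq_sum_card_fiberwise (f := fun π => (firstCut π, n - firstCut π))
    (t := Finset.HasAntidiagonal.antidiagonal n)]
  · refine Finset.sum_congr rfl ?_
    rintro ⟨k, l⟩ hkl
    obtain rfl : k + l = n := by simpa using hkl
    symm
    refine Finset.card_bij (fun q _ => skewSum q.1 q.2) ?_ ?_ ?_
    · rintro ⟨σ, τ⟩ hq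
      simp only [Finset.mem_filter, Finset.mem_univ, true_and] at hq ⊢
      rw [firstCut_skewSum hq.1]
      simp [hq.2]
    · rintro ⟨σ, τ⟩ _ ⟨σ', τ'⟩ _ h
      obtain ⟨rfl, rfl⟩ := skewSum_inj h
      rfl
    · intro π hπ
      simp only [Finset.mem_filter, Finset.mem_univ, true_and, Prod.mk.injEq] at hπ
      obtain ⟨hA, hk, -⟩ := hπ
      have hspec := firstCut_spec hn π
      rw [hk] at hspec
      obtain ⟨σ, τ, rfl⟩ := exists_eq_skewSum hspec.2
      refine ⟨(σ, τ), ?_, rfl⟩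
      simp only [Finset.mem_filter, Finset.mem_univ, true_and]
      refine ⟨mem_skewIndecomposables_iff.2 ⟨hspec.1, fun r hr hrk hcut => ?_⟩, hA⟩
      have := firstCut_le hr ((isCut_skewSum_iff (τ := τ) hrk.le).2 hcut)
      omega
  · intro π _
    have := firstCut_le hn (isCut_length π)
    simp only [Finset.mem_coe, Finset.HasAntidiagonal.mem_antidiagonal]
    omega

theorem isAscent_castAdd {i j : Fin k} :
    IsAscent (skewSum σ τ) (Fin.castAdd l i) (Fin.castAdd l j) ↔ IsAscent σ i j := by
  rw [IsAscent, IsAscent, skewSum_castAdd_lt_castAdd]; exact Iff.rfl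

theorem isAscent_natAdd {i j : Fin l} :
    IsAscent (skewSum σ τ) (Fin.natAdd k i) (Fin.natAdd k j) ↔ IsAscent τ i j := by
  rw [IsAscent, IsAscent, skewSum_natAdd_lt_natAdd]; simp

theorem isAscent_skewSum_iff {i j : Fin (k + l)} : IsAscent (skewSum σ τ) i j ↔
    (∃ a b, IsAscent σ a b ∧ i = Fin.castAdd l a ∧ j = Fin.castAdd l b) ∨
    ∃ a b, IsAscent τ a b ∧ i = Fin.natAdd k a ∧ j = Fin.natAdd k b := by
  constructor
  · intro h
    induction i using Fin.addCases with
    | left i =>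
      induction j using Fin.addCases with
      | left j => exact Or.inl ⟨i, j, isAscent_castAdd.1 h, rfl, rfl⟩
      | right j => exact absurd h.2 (skewSum_natAdd_lt_castAdd i j).not_gt
    | right i =>
      induction j using Fin.addCases with
      | left j =>
        have := Fin.lt_def.1 h.1
        simp at this
        omega
      | right j => exact Or.inr ⟨i, j, isAscent_natAdd.1 h, rfl, rfl⟩
  · rintro (⟨a, b, h, rfl, rfl⟩ | ⟨a, b, h, rfl, rfl⟩)
    · exact isAscent_castAdd.2 h
    · exact isAscent_natAdd.2 h

theorem hasSeparatingCut_skewSum_of_one {σ : Perm (Fin 1)} :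
    HasSeparatingCut (skewSum σ τ) ↔ HasSeparatingCut τ := by
  have hσ : ∀ a b, ¬ IsAscent σ a b := fun a b h => by
    have := h.1; omega
  constructor
  · rintro ⟨r, hr, ⟨i, j, hij, hjr⟩, ⟨i', j', hij', hir'⟩⟩
    rcases isAscent_skewSum_iff.1 hij with ⟨a, b, h, -, -⟩ | ⟨a, b, h, rfl, rfl⟩
    · exact absurd h (hσ a b)
    rcases isAscent_skewSum_iff.1 hij' with ⟨a', b', h', -, -⟩ | ⟨a', b', h', rfl, rfl⟩
    · exact absurd h' (hσ a' b')
    simp only [Fin.val_natAdd] at hjr hir'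
    -- No truncation occurs, since `1 + b < r`.
    refine ⟨r - 1, fun x y hx hy => ?_, ⟨a, b, h, by omega⟩, ⟨a', b', h', by omega⟩⟩
    exact skewSum_natAdd_lt_natAdd.1 (hr (Fin.natAdd 1 x) (Fin.natAdd 1 y)
      (by rw [Fin.val_natAdd]; omega) (by rw [Fin.val_natAdd]; omega))
  · rintro ⟨r, hr, ⟨i, j, hij, hjr⟩, ⟨i', j', hij', hir'⟩⟩
    refine ⟨1 + r, fun x y hx hy => ?_, ⟨_, _, isAscent_natAdd.2 hij,
      by simpa [add_comm] using hjr⟩, ⟨_, _, isAscent_natAdd.2 hij',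
      by simpa [add_comm] using hir'⟩⟩
    induction y using Fin.addCases with
    | left y => rw [Fin.val_castAdd] at hy; omega
    | right y =>
      induction x using Fin.addCases with
      | left x => exact skewSum_natAdd_lt_castAdd x y
      | right x =>
        simp only [Fin.val_natAdd] at hx hy
        exact skewSum_natAdd_lt_natAdd.2 (hr x y (by omega) (by omega))

theorem exists_isAscent (hσ : (⟨k, σ⟩ : AllPerm) ∈ skewIndecomposables) (hk : 1 < k) :
    ∃ i j, IsAscent σ i j := by
  by_contra! h
  refine (mem_skewIndecomposables_iff.1 hσ).2 1 one_pos hk fun i j hi hj => ?_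
  have hij : i < j := Fin.lt_def.2 (by omega)
  exact lt_of_le_of_ne (not_lt.1 fun h' => h i j ⟨hij, h'⟩) (σ.injective.ne hij.ne')

theorem hasSeparatingCut_skewSum (hσ : (⟨k, σ⟩ : AllPerm) ∈ skewIndecomposables) (hk : 1 < k) :
    HasSeparatingCut (skewSum σ τ) ↔ ∃ i j, IsAscent τ i j := by
  constructor
  · rintro ⟨r, hr, ⟨i, j, hij, hjr⟩, ⟨i', j', hij', hir'⟩⟩
    rcases isAscent_skewSum_iff.1 hij' with ⟨a', b', h', rfl, rfl⟩ | ⟨a', b', h', -, -⟩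
    · simp only [Fin.val_castAdd] at hir'
      exact absurd ((isCut_skewSum_iff (by omega)).1 hr)
        ((mem_skewIndecomposables_iff.1 hσ).2 r (by omega) (by omega))
    · exact ⟨a', b', h'⟩
  · rintro ⟨i, j, hij⟩
    obtain ⟨a, b, hab⟩ := exists_isAscent hσ hk
    exact ⟨k, (isCut_skewSum_iff le_rfl).2 (isCut_length σ),
      ⟨_, _, isAscent_castAdd.2 hab, by simp⟩, ⟨_, _, isAscent_natAdd.2 hij, by simp⟩⟩

theorem forall_not_isAscent_iff : (∀ i j, ¬ IsAscent τ i j) ↔ τ = Fin.revPerm := by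
  constructor
  · intro h
    have hanti : StrictAnti τ := fun i j hij =>
      lt_of_le_of_ne (not_lt.1 fun h' => h i j ⟨hij, h'⟩) (τ.injective.ne hij.ne')
    have hmono : StrictMono ⇑(τ * Fin.revPerm : Perm (Fin l)) := fun i j hij => by
      simpa only [Perm.mul_apply, Fin.revPerm_apply] using hanti (Fin.rev_lt_rev.2 hij)
    -- The only order automorphism of `Fin l` is the identity.
    have hid : ∀ i, (τ * Fin.revPerm : Perm (Fin l)) i = i := fun i =>
      DFunLike.congr_fun (Subsingleton.elim (hmono.orderIsoOfSurjective _
        (τ * Fin.revPerm : Perm (Fin l)).surjective) (OrderIso.refl (Fin l))) i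
    ext i
    have := hid (Fin.rev i)
    simp only [Perm.mul_apply, Fin.revPerm_apply, Fin.rev_rev] at this
    rw [this, Fin.revPerm_apply]
  · rintro rfl i j ⟨h1, h2⟩
    exact lt_asymm h1 (Fin.rev_lt_rev.1 h2)

end OccGraph

/-! ### Generating functions -/

namespace OccGraph

open Equiv PowerSeries

theorem mem_skewIndecomposables_one (σ : Perm (Fin 1)) :
    (⟨1, σ⟩ : AllPerm) ∈ skewIndecomposables :=
  mem_skewIndecomposables_iff.2 ⟨one_pos, fun r h1 h2 => by omega⟩

theorem card_skewIndecomposables_one :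
    Nat.card {σ : Perm (Fin 1) // (⟨1, σ⟩ : AllPerm) ∈ skewIndecomposables} = 1 := by
  simp [mem_skewIndecomposables_one]

theorem factorial_series_eq :
    (PowerSeries.mk fun k => (k.factorial : ℚ)) =
      1 + genFun skewIndecomposables * PowerSeries.mk fun k => (k.factorial : ℚ) := by
  ext n
  rw [map_add, coeff_mul, coeff_mk, coeff_one]
  simp only [coeff_mk, genFun]
  rcases Nat.eq_zero_or_pos n with rfl | hn
  · simp [mem_skewIndecomposables_iff]
  · have h := card_eq_sum_antidiagonal Set.univ hn
    simp only [Set.mem_univ, and_true] at h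
    rw [if_neg hn.ne', zero_add]
    have hn' : Nat.card {π : Perm (Fin n) // True} = n.factorial := by
      simp [Nat.card_eq_fintype_card, Fintype.card_perm]
    rw [← hn', h, Nat.cast_sum]
    refine Finset.sum_congr rfl fun p _ => ?_
    rw [← Nat.cast_mul]
    congr 1
    have hp : p.2.factorial = Nat.card (Perm (Fin p.2)) := by
      simp [Nat.card_eq_fintype_card, Fintype.card_perm]
    rw [hp, ← Nat.card_prod]
    exact Nat.card_congr (Equiv.prodSubtypeFstEquivSubtypeProd (α := Perm (Fin p.1))
      (p := fun σ => (⟨p.1, σ⟩ : AllPerm) ∈ skewIndecomposables))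

theorem genFun_skewIndecomposables : genFun skewIndecomposables = F := by
  have h : (1 - genFun skewIndecomposables) * (PowerSeries.mk fun k => (k.factorial : ℚ)) = 1 := by
    rw [sub_mul, one_mul, sub_eq_iff_eq_add]
    exact factorial_series_eq
  rw [F, ← (PowerSeries.eq_inv_iff_mul_eq_one (by simp)).2 h, sub_sub_cancel]

/-- The permutations whose graph of occurrences of `12` is connected. -/
abbrev connected12 : Set AllPerm := graphClass p12 (fun _ G => G.Preconnected)

theorem mem_connected12_iff {n : ℕ} {π : Perm (Fin n)} :
    (⟨n, π⟩ : AllPerm) ∈ connected12 ↔ ¬ HasSeparatingCut π :=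
  preconnected_iff

/-- The first term counts `k = 1`, with any connected `τ`; the second counts `k > 1`, where `τ` is
the one decreasing permutation. -/
theorem card_pairs_connected12 (k l : ℕ) :
    (Nat.card {q : Perm (Fin k) × Perm (Fin l) // (⟨k, q.1⟩ : AllPerm) ∈ skewIndecomposables ∧
      (⟨k + l, skewSum q.1 q.2⟩ : AllPerm) ∈ connected12} : ℚ) =
    coeff k X * coeff l (genFun connected12) + coeff k (genFun skewIndecomposables - X) := by
  simp only [mem_connected12_iff, map_sub, genFun, coeff_mk, coeff_X]
  rcases (by omega : k = 0 ∨ k = 1 ∨ 1 < k) with rfl | rfl | hk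
  · simp [mem_skewIndecomposables_iff]
  · rw [card_skewIndecomposables_one]
    simp only [mem_skewIndecomposables_one, hasSeparatingCut_skewSum_of_one, true_and, if_true,
      one_mul, Nat.cast_one, sub_self, add_zero, Nat.cast_inj]
    exact Nat.card_congr
      { toFun := fun q => ⟨q.1.2, q.2⟩
        invFun := fun τ => ⟨(1, τ.1), τ.2⟩
        left_inv := fun q => Subtype.ext (Prod.ext (Subsingleton.elim _ _) rfl)
        right_inv := fun _ => rfl }
  · rw [if_neg hk.ne', zero_mul, zero_add, sub_zero, Nat.cast_inj]
    refine Nat.card_congr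
      { toFun := fun q => ⟨q.1.1, q.2.1⟩
        invFun := fun σ => ⟨(σ.1, Fin.revPerm), σ.2, ?_⟩
        left_inv := ?_
        right_inv := fun _ => rfl }
    · rw [hasSeparatingCut_skewSum σ.2 hk]
      simpa using forall_not_isAscent_iff.2 rfl
    · rintro ⟨⟨σ, τ⟩, hσ, hτ⟩
      rw [hasSeparatingCut_skewSum hσ hk] at hτ
      push Not at hτ
      obtain rfl := forall_not_isAscent_iff.1 hτ
      rfl

theorem genFun_connected12_eq_add :
    genFun connected12 = 1 + X * genFun connected12 +
      (genFun skewIndecomposables - X) * PowerSeries.mk 1 := by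
  ext n
  rw [map_add, map_add, coeff_mul, coeff_mul, add_assoc, ← Finset.sum_add_distrib, coeff_one]
  rcases Nat.eq_zero_or_pos n with rfl | hn
  · have h : ∀ π : Perm (Fin 0), ¬ HasSeparatingCut π := by
      rintro π ⟨_, _, ⟨i, -⟩, -⟩
      exact i.elim0
    simp [genFun, mem_connected12_iff, h, mem_skewIndecomposables_iff]
  · rw [if_neg hn.ne', zero_add]
    conv_lhs => rw [genFun, coeff_mk, card_eq_sum_antidiagonal connected12 hn, Nat.cast_sum]
    refine Finset.sum_congr rfl fun p _ => ?_
    rw [card_pairs_connected12, coeff_mk, Pi.one_apply, mul_one]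

theorem genFun_connected12 :
    genFun connected12 = (F - X) * ((1 - X) ^ 2)⁻¹ + (1 - X)⁻¹ := by
  have h1 : (PowerSeries.mk 1 : PowerSeries ℚ) * (1 - X) = 1 :=
    PowerSeries.mk_one_mul_one_sub_eq_one ℚ
  have h2 : (PowerSeries.mk 1 : PowerSeries ℚ) ^ 2 * (1 - X) ^ 2 = 1 := by
    rw [← mul_pow, h1, one_pow]
  rw [← (PowerSeries.eq_inv_iff_mul_eq_one (by simp)).2 h1,
    ← (PowerSeries.eq_inv_iff_mul_eq_one (by simp)).2 h2, ← genFun_skewIndecomposables]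
  linear_combination (PowerSeries.mk 1 : PowerSeries ℚ) * genFun_connected12_eq_add -
    genFun connected12 * h1

end OccGraph

theorem mainTheorem4 :
    OccGraph.graphClass OccGraph.p12 (fun _ G => G.Preconnected) = OccGraph.meshAv OccGraph.m ∧
    OccGraph.genFun (OccGraph.graphClass OccGraph.p12 (fun _ G => G.Preconnected)) =
      (OccGraph.F - PowerSeries.X) * ((1 - PowerSeries.X) ^ 2)⁻¹ + (1 - PowerSeries.X)⁻¹ ∧
    OccGraph.genFun OccGraph.skewIndecomposables = OccGraph.F :=
  ⟨OccGraph.graphClass_eq, OccGraph.genFun_connected12, OccGraph.genFun_skewIndecomposables⟩
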